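/- Let $p$ be a prime, let $k$ be a number field containing a primitive $p$th root of unity $\zeta$, and let $\bar k$ be an algebraic closure of $k$. Let $C/k$ be a nice (smooth, projective, geometrically integral) curve and let $\psi : C \to C$ be a $k$-rational automorphism of order $p$. For $d \in k^\times$, the Kummer twist $C_d$ of $C$ by $\psi$ is the $k$-scheme, unique up to isomorphism, that admits a $\bar k$-isomorphism $\varphi : (C_d)_{\bar k} \to C_{\bar k}$ whose failure to be Galois-equivariant is measured by the cocycle $\sigma \mapsto \psi^{a(\sigma)}$, where $\sigma(d^{1/p}) = \zeta^{a(\sigma)} d^{1/p}$ for $\sigma \in \mathrm{Gal}(\bar k/k)$; it becomes isomorphic to $C$ over $L = k(d^{1/p})$, and up to isomorphism it depends only on the class of $d$ in $k^\times/(k^\times)^p$. (With the sign convention for which, if $C : y^p = f(x)$ and $\psi(x,y) = (x,\zeta y)$, then $C_d : d y^p = f(x)$.) Let $C/\langle\psi\rangle$ be the quotient curve. Assume that (i) $\{P \in C(k) : \psi(P) = P\} = \emptyset$; (ii) $\{P \in C(\bar k) : \psi(P) = P\} \neq \emptyset$; (iii) the set $(C/\langle\psi\rangle)(k)$ is finite.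 Then there are only finitely many classes $d \in k^\times/(k^\times)^p$ for which $C_d$ has a $k$-rational point. In other words, all but finitely many Kummer twists $C_d$ have no $k$-rational points. -/

import Mathlib

open CategoryTheory CategoryTheory.Limits AlgebraicGeometry

universe u

noncomputable section

namespace KummerTwist

/-- The morphism `Spec B ⟶ Spec A` attached to a ring homomorphism `A →+* B`. -/
abbrev specMap {A B : Type u} [CommRing A] [CommRing B] (f : A →+* B) :
    Spec (CommRingCat.of B) ⟶ Spec (CommRingCat.of A) :=
  Spec.map (CommRingCat.ofHom f)

section Curves

variable (k : Type u) [Field k]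

attribute [local instance] MvPolynomial.gradedAlgebra

/-- Projective space `ℙⁿ` over `k`, as `Proj k[x₀, …, xₙ]` with its standard grading. -/
abbrev projSpace (n : ℕ) : Scheme.{u} :=
  Proj (MvPolynomial.homogeneousSubmodule (Fin (n + 1)) k)

/-- The structure morphism `ℙⁿ ⟶ Spec k`. -/
def projSpaceHom (n : ℕ) : projSpace k n ⟶ Spec (CommRingCat.of k) :=
  Proj.toSpecZero (MvPolynomial.homogeneousSubmodule (Fin (n + 1)) k) ≫
    specMap (algebraMap k (MvPolynomial.homogeneousSubmodule (Fin (n + 1)) k 0))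

variable {k}

/-- `X` is projective over `k`: it is a closed subscheme of some `ℙⁿ` over `k`. -/
def IsProjective (X : Over (Spec (CommRingCat.of k))) : Prop :=
  ∃ (n : ℕ) (i : X.left ⟶ projSpace k n), IsClosedImmersion i ∧ i ≫ projSpaceHom k n = X.hom

/-- A nice curve over `k`: smooth of relative dimension one, projective, geometrically integral. -/
structure IsNiceCurve (X : Over (Spec (CommRingCat.of k))) : Prop where
  smooth : SmoothOfRelativeDimension 1 X.hom
  projective : IsProjective X
  geomIntegral : GeometricallyIntegral X.hom

/-- The set `X(K)` of `K`-rational points of a `k`-scheme `X`: the `k`-morphisms `Spec K ⟶ X`. -/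
abbrev RatPoints (X : Over (Spec (CommRingCat.of k))) (K : Type u) [Field K] [Algebra k K] :
    Type u :=
  Over.mk (specMap (algebraMap k K)) ⟶ X

end Curves

section Quotients

variable {S : Scheme.{u}}

/-- If `π ∘ ψ = π`, then `ψ` maps every open set `π⁻¹(U)` to itself. -/
theorem preimage_le {C D : Over S} {ψ : C ⟶ C} {π : C ⟶ D} (h : ψ ≫ π = π) (U : D.left.Opens) :
    π.left ⁻¹ᵁ U ≤ ψ.left ⁻¹ᵁ (π.left ⁻¹ᵁ U) := by
  have h' : ψ.left ≫ π.left = π.left := by rw [← Over.comp_left, h]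
  rw [← Scheme.Hom.comp_preimage, h']

/-- `π : C ⟶ D` is the quotient of `C` by the group generated by the automorphism `ψ`:
`π` is affine, `π ∘ ψ = π`, and `𝒪_D ⟶ π_* 𝒪_C` identifies `𝒪_D` with the sheaf
`(π_* 𝒪_C)^ψ` of `ψ`-invariant functions. -/
structure IsQuotientBy {C D : Over S} (ψ : Aut C) (π : C ⟶ D) : Prop where
  affine : IsAffineHom π.left
  invariant : ψ.hom ≫ π = π
  injective : ∀ U : D.left.Opens, Function.Injective (π.left.app U).hom
  mem_range_iff : ∀ (U : D.left.Opens) (s : Γ(C.left, π.left ⁻¹ᵁ U)),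
    s ∈ Set.range (π.left.app U).hom ↔
      (ψ.hom.left.appLE (π.left ⁻¹ᵁ U) (π.left ⁻¹ᵁ U) (preimage_le invariant U)).hom s = s

end Quotients

section Twists

variable {k : Type u} [Field k]

/-- The base change of `X` to the algebraic closure of `k`. -/
abbrev geomFiber (X : Over (Spec (CommRingCat.of k))) : Scheme.{u} :=
  pullback X.hom (specMap (algebraMap k (AlgebraicClosure k)))

/-- The base change of a `k`-morphism to the algebraic closure of `k`. -/
def geomMap {X Y : Over (Spec (CommRingCat.of k))} (f : X ⟶ Y) : geomFiber X ⟶ geomFiber Y :=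
  pullback.map _ _ _ _ f.left (𝟙 _) (𝟙 _) (by simp) (by simp)

/-- The semilinear action `1 × Spec σ` of a Galois automorphism `σ` on the base change of `X`. -/
def galMap (X : Over (Spec (CommRingCat.of k)))
    (σ : AlgebraicClosure k ≃ₐ[k] AlgebraicClosure k) : geomFiber X ⟶ geomFiber X :=
  pullback.map _ _ _ _ (𝟙 _) (specMap (σ : AlgebraicClosure k →+* AlgebraicClosure k)) (𝟙 _)
    (by simp) (by
      rw [Category.comp_id, specMap, specMap, ← Spec.map_comp, ← CommRingCat.ofHom_comp]
      congr 2
      ext x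
      simp)

/-- `Y` is the Kummer twist `C_d` of `C` by the automorphism `ψ`, where `ζ` is a primitive `p`-th
root of unity in `k` and `ψ ^ p = 1`: there is an isomorphism `φ` from `Y` to `C` over the
algebraic closure whose failure to be Galois equivariant is the cocycle `σ ↦ ψ ^ a(σ)`, where
`σ(δ) = ζ ^ a(σ) δ` for a `p`-th root `δ` of `d`. -/
def IsKummerTwist (p : ℕ) (ζ : k) {C : Over (Spec (CommRingCat.of k))} (ψ : Aut C) (d : k)
    (Y : Over (Spec (CommRingCat.of k))) : Prop :=
  ∃ φ : geomFiber Y ≅ geomFiber C,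
    φ.hom ≫ pullback.snd _ _ = pullback.snd _ _ ∧
    ∀ (δ : AlgebraicClosure k), δ ^ p = algebraMap k (AlgebraicClosure k) d →
      ∀ (σ : AlgebraicClosure k ≃ₐ[k] AlgebraicClosure k) (a : ℕ),
        σ δ = algebraMap k (AlgebraicClosure k) ζ ^ a * δ →
          galMap Y σ ≫ φ.hom = φ.hom ≫ galMap C σ ≫ geomMap (ψ ^ a).hom

end Twists

end KummerTwist

end

/-!
A rational point of the twist `C_d` amounts to a geometric point `x` of `C` on which every Galois
automorphism `σ` acts as `ψ ^ a(σ)`, where `a` is the Kummer cocycle of `d`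
(`exists_isTwistedPoint`). Its image in the quotient `D` is therefore Galois invariant, and Galois
descent for field-valued points (`exists_ratPoint_of_forall_galois`) makes it a `k`-rational point
of `D`. As `D(k)` is finite, it suffices that this point of `D` determines the class of `d`.

Two geometric points of `C` with the same image in `D` differ by a power of `ψ`
(`IsQuotientBy.exists_comp_pow_eq`). On an affine chart this is the statement that two
homomorphisms from a ring `A` to a domain which agree on the invariants of an automorphism `τ` of
finite order differ by a power of `τ` (`exists_eq_comp_pow_of_eq_on_fixed`). Hence, if points
`x, x'` coming from `d, d'` lie over the same point of `D`, then
`ψ ^ a(σ)` and `ψ ^ a'(σ)` agree on `x'`. If `a(σ)` and `a'(σ)` differ modulo `p` for some `σ`,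
then `x'` is fixed by `ψ`, hence Galois invariant, hence a `k`-rational fixed point of `ψ`, and
there are none. So the Kummer cocycles of `d` and `d'` coincide, which means that `d / d'` is a
`p`-th power in `k`.
-/

universe v

namespace KummerTwist

/-! ### Ring homomorphisms agreeing on invariants -/

section Invariants

open Polynomial

variable {A K : Type*} [CommRing A] [CommRing K] [IsDomain K]

/-- The polynomial `∏ (X - τ ^ i a)` has `τ`-invariant coefficients, so it has the same image under
`f` and `g`; the root `g a` of this image is one of the `f (τ ^ i a)`. -/
theorem exists_eq_apply_pow_of_eq_on_fixed (τ : A →+* A) {n : ℕ} (hn : 0 < n) (hτ : τ ^ n = 1)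
    {f g : A →+* K} (hfg : ∀ a, τ a = a → f a = g a) (a : A) :
    ∃ i < n, g a = f ((τ ^ i) a) := by
  set q : A[X] := ∏ i ∈ Finset.range n, (X - C ((τ ^ i) a)) with hq
  have hqτ : q.map τ = q := by
    obtain ⟨m, rfl⟩ : ∃ m, n = m + 1 := ⟨n - 1, by omega⟩
    have h1 : q.map τ = ∏ i ∈ Finset.range (m + 1), (X - C ((τ ^ (i + 1)) a)) := by
      rw [hq, Polynomial.map_prod]
      refine Finset.prod_congr rfl fun i _ => ?_
      simp [pow_succ' τ i]
    rw [h1, hq, Finset.prod_range_succ, Finset.prod_range_succ', hτ, pow_zero]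
  have hqfg : q.map f = q.map g := by
    ext i
    rw [coeff_map, coeff_map]
    refine hfg _ ?_
    rw [← coeff_map, hqτ]
  have h0 : (q.map g).eval (g a) = 0 := by
    rw [hq, Polynomial.map_prod, eval_prod]
    exact Finset.prod_eq_zero (Finset.mem_range.2 hn) (by simp)
  rw [← hqfg, hq, Polynomial.map_prod, eval_prod, Finset.prod_eq_zero_iff] at h0
  obtain ⟨i, hi, h⟩ := h0
  refine ⟨i, Finset.mem_range.1 hi, ?_⟩
  simpa [sub_eq_zero] using h

theorem mapRingHom_pow (τ : A →+* A) (n : ℕ) : mapRingHom τ ^ n = mapRingHom (τ ^ n) := by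
  induction n with
  | zero => ext <;> simp
  | succ n ih => rw [pow_succ, pow_succ, ih]; ext <;> simp

/-- The exponent in `exists_eq_apply_pow_of_eq_on_fixed` can be chosen independently of the
element: apply that lemma over `A[X]` to the polynomial whose `i`-th coefficient is a
counterexample to the exponent `i`. -/
theorem exists_eq_comp_pow_of_eq_on_fixed (τ : A →+* A) {n : ℕ} (hn : 0 < n) (hτ : τ ^ n = 1)
    {f g : A →+* K} (hfg : ∀ a, τ a = a → f a = g a) :
    ∃ i, g = f.comp (τ ^ i) := by
  by_contra! h
  have h' : ∀ i, ∃ a, g a ≠ f ((τ ^ i) a) := fun i => by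
    by_contra! hc
    exact h i (RingHom.ext hc)
  choose c hc using h'
  obtain ⟨i, hi, e⟩ := exists_eq_apply_pow_of_eq_on_fixed (mapRingHom τ) hn
    (by rw [mapRingHom_pow, hτ]; ext <;> simp) (f := mapRingHom f) (g := mapRingHom g)
    (fun q hq => by
      ext j
      simp only [coe_mapRingHom, coeff_map]
      refine hfg _ ?_
      conv_rhs => rw [← hq]
      simp)
    (∑ j ∈ Finset.range n, monomial j (c j))
  refine hc i ?_
  have e' := congrArg (fun q => q.coeff i) e
  simpa [mapRingHom_pow, coeff_monomial, hi, Polynomial.finsetSum_coeff,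
    Finset.sum_ite_eq'] using e'

end Invariants

/-! ### Geometric points over a point of the quotient -/

section Quotient

variable {S : Scheme.{v}} {C D : Over S} {ψ : Aut C} {π : C ⟶ D}

theorem aut_pow_succ_hom (ψ : Aut C) (n : ℕ) : (ψ ^ (n + 1)).hom = ψ.hom ≫ (ψ ^ n).hom := by
  rw [pow_succ]; rfl

theorem aut_pow_add_hom (ψ : Aut C) (m n : ℕ) :
    (ψ ^ (m + n)).hom = (ψ ^ n).hom ≫ (ψ ^ m).hom := by
  rw [pow_add]; rfl

theorem pow_comp_eq (h : ψ.hom ≫ π = π) (n : ℕ) : (ψ ^ n).hom ≫ π = π := by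
  induction n with
  | zero => exact Category.id_comp π
  | succ n ih => rw [aut_pow_succ_hom, Category.assoc, ih, h]

theorem appLE_eq_id {X : Scheme.{v}} {f : X ⟶ X} (hf : f = 𝟙 X) {V : X.Opens}
    (h : V ≤ f ⁻¹ᵁ V) : f.appLE V V h = 𝟙 _ := by
  subst hf
  change 𝟙 Γ(X, V) ≫ X.presheaf.map (𝟙 _) = 𝟙 _
  rw [X.presheaf.map_id, Category.comp_id]

theorem appLE_pow (h : ψ.hom ≫ π = π) (U : D.left.Opens) (n : ℕ) :
    ((ψ ^ n).hom.left.appLE (π.left ⁻¹ᵁ U) (π.left ⁻¹ᵁ U) (preimage_le (pow_comp_eq h n) U)).hom =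
      (ψ.hom.left.appLE (π.left ⁻¹ᵁ U) (π.left ⁻¹ᵁ U) (preimage_le h U)).hom ^ n := by
  induction n with
  | zero =>
    have : (ψ ^ 0).hom.left = 𝟙 C.left := rfl
    rw [appLE_eq_id this, pow_zero]
    rfl
  | succ n ih =>
    have : (ψ ^ (n + 1)).hom.left = ψ.hom.left ≫ (ψ ^ n).hom.left := by
      rw [aut_pow_succ_hom, Over.comp_left]
    simp only [this]
    rw [← Scheme.Hom.appLE_comp_appLE _ _ _ _ _ (preimage_le (pow_comp_eq h n) U)
      (preimage_le h U), CommRingCat.hom_comp, ih, pow_succ']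
    rfl

theorem eq_of_appLE_eq {X Y : Scheme.{v}} [IsAffine X] {f g : X ⟶ Y} {V : Y.Opens}
    (hV : IsAffineOpen V) (hf : ⊤ ≤ f ⁻¹ᵁ V) (hg : ⊤ ≤ g ⁻¹ᵁ V)
    (h : f.appLE V ⊤ hf = g.appLE V ⊤ hg) : f = g := by
  have hX := isAffineOpen_top X
  have : IsIso hX.fromSpec := by
    rw [IsAffineOpen.fromSpec_top]
    infer_instance
  rw [← cancel_epi hX.fromSpec, ← hV.SpecMap_appLE_fromSpec f hX hf,
    ← hV.SpecMap_appLE_fromSpec g hX hg, h]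

/-- The group generated by `ψ` acts transitively on the field-valued points of `C` over a given
point of the quotient `D`. -/
theorem IsQuotientBy.exists_comp_pow_eq (hπ : IsQuotientBy ψ π) {n : ℕ} (hn : 0 < n)
    (hψ : ψ ^ n = 1) {K : Type v} [Field K] {x y : Spec (CommRingCat.of K) ⟶ C.left}
    (hxy : x ≫ π.left = y ≫ π.left) :
    ∃ i : ℕ, y = x ≫ (ψ ^ i).hom.left := by
  obtain ⟨P⟩ : Nonempty (Spec (CommRingCat.of K)) := inferInstance
  obtain ⟨U, hU, hPU, -⟩ := exists_isAffineOpen_mem_and_subset (X := D.left)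
    (x := (x ≫ π.left) P) (U := ⊤) trivial
  have hV : IsAffineOpen (π.left ⁻¹ᵁ U) := by
    have := hπ.affine
    exact hU.preimage π.left
  have : Subsingleton (Spec (CommRingCat.of K)) :=
    inferInstanceAs (Subsingleton (PrimeSpectrum K))
  have hx : ⊤ ≤ x ⁻¹ᵁ (π.left ⁻¹ᵁ U) := fun Q _ => by
    rw [Subsingleton.elim Q P]
    simpa using hPU
  have hy : ⊤ ≤ y ⁻¹ᵁ (π.left ⁻¹ᵁ U) := fun Q _ => by
    rw [Subsingleton.elim Q P]
    rw [hxy] at hPU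
    simpa using hPU
  obtain ⟨i, hi⟩ := exists_eq_comp_pow_of_eq_on_fixed
    (ψ.hom.left.appLE (π.left ⁻¹ᵁ U) (π.left ⁻¹ᵁ U) (preimage_le hπ.invariant U)).hom hn
    (by
      have : (ψ ^ n).hom.left = 𝟙 C.left := by rw [hψ]; rfl
      rw [← appLE_pow hπ.invariant, appLE_eq_id this]
      rfl)
    (f := (x.appLE (π.left ⁻¹ᵁ U) ⊤ hx).hom) (g := (y.appLE (π.left ⁻¹ᵁ U) ⊤ hy).hom)
    (fun s hs => by
      obtain ⟨t, rfl⟩ := (hπ.mem_range_iff U s).2 hs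
      have key : π.left.app U ≫ x.appLE (π.left ⁻¹ᵁ U) ⊤ hx =
          π.left.app U ≫ y.appLE (π.left ⁻¹ᵁ U) ⊤ hy := by
        rw [← Scheme.Hom.appLE_eq_app, Scheme.Hom.appLE_comp_appLE, Scheme.Hom.appLE_comp_appLE]
        simp only [hxy]
      exact congrArg (fun r => r.hom t) key)
  refine ⟨i, eq_of_appLE_eq hV hy ?_ ?_⟩
  · rw [Scheme.Hom.comp_preimage]
    exact hx.trans (x.preimage_mono (preimage_le (pow_comp_eq hπ.invariant i) U))
  · rw [← Scheme.Hom.appLE_comp_appLE _ _ _ _ _ (preimage_le (pow_comp_eq hπ.invariant i) U) hx]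
    ext1
    rw [hi, CommRingCat.hom_comp, appLE_pow hπ.invariant]

end Quotient

/-! ### Galois descent for field-valued points -/

section Descent

variable {k : Type v} [Field k]

instance epi_specMap {K L : Type v} [Field K] [Field L] (f : K →+* L) : Epi (specMap f) := by
  have : Flat (specMap f) := by
    rw [Flat.SpecMap_iff]
    let := f.toAlgebra
    exact (inferInstance : Module.Flat K L)
  have : Surjective (specMap f) := ⟨fun P =>
    ⟨Nonempty.some inferInstance, Subsingleton.elim (α := PrimeSpectrum K) _ _⟩⟩
  exact Flat.epi_of_flat_of_surjective _

/-- A point over a Galois extension that is invariant under the Galois group is rational over the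
base field: its residue field embeds into the fixed field. -/
theorem exists_ratPoint_of_forall_galois {K : Type v} [Field K] [Algebra k K] [IsGalois k K]
    (X : Over (Spec (CommRingCat.of k))) (x : Spec (CommRingCat.of K) ⟶ X.left)
    (hx : x ≫ X.hom = specMap (algebraMap k K))
    (hσ : ∀ σ : K ≃ₐ[k] K, specMap (σ : K →+* K) ≫ x = x) :
    ∃ P : RatPoints X k, specMap (algebraMap k K) ≫ P.left = x := by
  obtain ⟨⟨P, f⟩, rfl⟩ := (Scheme.SpecToEquivOfField K X.left).symm.surjective x
  change X.left.residueField P ⟶ CommRingCat.of K at f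
  have hf : ∀ a, f.hom a ∈ (algebraMap k K).range := fun a => by
    refine (InfiniteGalois.mem_range_algebraMap_iff_fixed _).2 fun σ => ?_
    have h1 : Spec.map (f ≫ CommRingCat.ofHom (σ : K →+* K)) = Spec.map f := by
      rw [← cancel_mono (X.left.fromSpecResidueField P), Spec.map_comp, Category.assoc]
      exact hσ σ
    exact congrArg (fun r => r.hom a) (Spec.map_injective h1)
  -- `f` corestricted to `k`.
  let e : k ≃+* (algebraMap k K).range := RingEquiv.ofBijective (algebraMap k K).rangeRestrict
    ⟨fun _ _ h => (algebraMap k K).injective (congrArg Subtype.val h),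
      (algebraMap k K).rangeRestrict_surjective⟩
  let g : X.left.residueField P →+* k := e.symm.toRingHom.comp (f.hom.codRestrict _ hf)
  have hg : (algebraMap k K).comp g = f.hom := RingHom.ext fun a =>
    congrArg Subtype.val (e.apply_symm_apply ⟨f.hom a, hf a⟩)
  have hgf : specMap (algebraMap k K) ≫ Spec.map (CommRingCat.ofHom g) = Spec.map f := by
    rw [specMap, ← Spec.map_comp, ← CommRingCat.ofHom_comp, hg]
    rfl
  have hfac : specMap (algebraMap k K) ≫ Spec.map (CommRingCat.ofHom g) ≫
      X.left.fromSpecResidueField P = (Scheme.SpecToEquivOfField K X.left).symm ⟨P, f⟩ := by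
    rw [← Category.assoc, hgf]
    rfl
  refine ⟨Over.homMk (Spec.map (CommRingCat.ofHom g) ≫ X.left.fromSpecResidueField P) ?_, ?_⟩
  · rw [← cancel_epi (specMap (algebraMap k K)), ← Category.assoc, hfac, hx]
    change _ = specMap _ ≫ specMap (RingHom.id k)
    rw [specMap, specMap, ← Spec.map_comp, ← CommRingCat.ofHom_comp, RingHom.comp_id]
  · exact hfac

end Descent

/-! ### Rational points of Kummer twists -/

section Twist

variable {k : Type v} [Field k]

/-- The geometric point `x` of `C` is twisted by the Kummer cocycle of `d`: whenever
`σ δ = ζ ^ a * δ` for a `p`-th root `δ` of `d`, the Galois automorphism `σ` acts on `x` as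
`ψ ^ a`. -/
structure IsTwistedPoint (p : ℕ) (ζ : k) {C : Over (Spec (CommRingCat.of k))} (ψ : Aut C) (d : k)
    (x : Spec (CommRingCat.of (AlgebraicClosure k)) ⟶ C.left) : Prop where
  comp_hom : x ≫ C.hom = specMap (algebraMap k (AlgebraicClosure k))
  galois : ∀ δ : AlgebraicClosure k, δ ^ p = algebraMap k (AlgebraicClosure k) d →
    ∀ (σ : AlgebraicClosure k ≃ₐ[k] AlgebraicClosure k) (a : ℕ),
      σ δ = algebraMap k (AlgebraicClosure k) ζ ^ a * δ →
        specMap (σ : AlgebraicClosure k →+* AlgebraicClosure k) ≫ x = x ≫ (ψ ^ a).hom.left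

variable {p : ℕ} {ζ : k} {C : Over (Spec (CommRingCat.of k))} {ψ : Aut C} {d : k}

/-- The geometric point of `C` corresponding to a rational point of a Kummer twist. -/
theorem exists_isTwistedPoint {Y : Over (Spec (CommRingCat.of k))}
    (hY : IsKummerTwist p ζ ψ d Y) (P : RatPoints Y k) :
    ∃ x, IsTwistedPoint p ζ ψ d x := by
  obtain ⟨φ, hφ, hgal⟩ := hY
  have hP : P.left ≫ Y.hom = 𝟙 _ := by
    rw [Over.w P]
    exact Spec.map_id _
  let s := specMap (algebraMap k (AlgebraicClosure k))
  let y : Spec (CommRingCat.of (AlgebraicClosure k)) ⟶ geomFiber Y :=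
    pullback.lift (s ≫ P.left) (𝟙 _) (by
      rw [Category.assoc, hP, Category.id_comp]
      exact Category.comp_id s)
  have hy₁ : y ≫ pullback.fst _ _ = s ≫ P.left := pullback.lift_fst _ _ _
  have hy₂ : y ≫ pullback.snd _ _ = 𝟙 _ := pullback.lift_snd _ _ _
  have hyσ : ∀ σ : AlgebraicClosure k ≃ₐ[k] AlgebraicClosure k,
      y ≫ galMap Y σ = specMap (σ : AlgebraicClosure k →+* AlgebraicClosure k) ≫ y := fun σ => by
    have hs : specMap (σ : AlgebraicClosure k →+* AlgebraicClosure k) ≫ s = s := by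
      simp only [s, specMap]
      rw [← Spec.map_comp, ← CommRingCat.ofHom_comp]
      congr 2
      ext a
      simp
    apply pullback.hom_ext
    · rw [galMap, Category.assoc, pullback.map, pullback.lift_fst, Category.comp_id,
        Category.assoc, hy₁, reassoc_of% hs]
    · rw [galMap, Category.assoc, pullback.map, pullback.lift_snd, Category.assoc, hy₂,
        reassoc_of% hy₂, Category.comp_id]
  refine ⟨y ≫ φ.hom ≫ pullback.fst _ _, ?_, fun δ hδ σ a ha => ?_⟩
  · rw [Category.assoc, Category.assoc, pullback.condition, reassoc_of% hφ, reassoc_of% hy₂]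
  · rw [← reassoc_of% hyσ σ, reassoc_of% hgal δ hδ σ a ha]
    have hfst : galMap C σ ≫ geomMap (ψ ^ a).hom ≫ pullback.fst _ _ =
        pullback.fst _ _ ≫ (ψ ^ a).hom.left := by
      rw [geomMap, pullback.map, pullback.lift_fst, galMap, pullback.map, pullback.lift_fst_assoc,
        Category.comp_id]
    simp only [Category.assoc]
    rw [hfst]

/-- The Kummer cocycle of `d`. -/
theorem exists_galois_exponent (hp : 0 < p) (hζ : IsPrimitiveRoot ζ p) {δ : AlgebraicClosure k}
    (hδ : δ ^ p = algebraMap k (AlgebraicClosure k) d)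
    (σ : AlgebraicClosure k ≃ₐ[k] AlgebraicClosure k) :
    ∃ a : ℕ, σ δ = algebraMap k (AlgebraicClosure k) ζ ^ a * δ := by
  by_cases h0 : δ = 0
  · exact ⟨0, by simp [h0]⟩
  have : NeZero p := ⟨hp.ne'⟩
  have hζ' := hζ.map_of_injective (algebraMap k (AlgebraicClosure k)).injective
  obtain ⟨a, -, ha⟩ := hζ'.eq_pow_of_pow_eq_one (ξ := σ δ / δ) (by
    rw [div_pow, ← map_pow, hδ, AlgEquiv.commutes, ← hδ, div_self (pow_ne_zero _ h0)])
  exact ⟨a, by rw [ha, div_mul_cancel₀ _ h0]⟩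

/-- The image of a twisted point in the quotient is rational over `k`. -/
theorem IsTwistedPoint.exists_ratPoint [CharZero k] (hp : 0 < p)
    (hζ : IsPrimitiveRoot ζ p) {x : Spec (CommRingCat.of (AlgebraicClosure k)) ⟶ C.left}
    (hx : IsTwistedPoint p ζ ψ d x) {D : Over (Spec (CommRingCat.of k))} {π : C ⟶ D}
    (hπ : ψ.hom ≫ π = π) :
    ∃ P : RatPoints D k,
      specMap (algebraMap k (AlgebraicClosure k)) ≫ P.left = x ≫ π.left := by
  refine exists_ratPoint_of_forall_galois D _ ?_ fun σ => ?_
  · rw [Category.assoc, Over.w π, hx.comp_hom]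
  · obtain ⟨δ, hδ⟩ := IsAlgClosed.exists_pow_nat_eq (algebraMap k (AlgebraicClosure k) d) hp
    obtain ⟨a, ha⟩ := exists_galois_exponent hp hζ hδ σ
    have : (ψ ^ a).hom.left ≫ π.left = π.left := by rw [← Over.comp_left, pow_comp_eq hπ]
    rw [← Category.assoc, hx.galois δ hδ σ a ha, Category.assoc, this]

/-- If `ψ` has prime order, then a point fixed by a nontrivial power of `ψ` is fixed by `ψ`. -/
theorem comp_eq_of_comp_pow_eq {S : Scheme.{v}} {C : Over S} {ψ : Aut C} {X : Scheme.{v}}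
    (hp : p.Prime) (hψ : ψ ^ p = 1) {x : X ⟶ C.left} {a b : ℕ}
    (h : x ≫ (ψ ^ a).hom.left = x ≫ (ψ ^ b).hom.left) (hab : ¬ a ≡ b [MOD p]) :
    x ≫ ψ.hom.left = x := by
  have hmul : ∀ (χ χ' : Aut C), (χ * χ').hom.left = χ'.hom.left ≫ χ.hom.left := fun _ _ => rfl
  -- The exponents of `ψ` fixing `x` form a subgroup of `ℤ` containing `p` and `a - b`.
  let H : AddSubgroup ℤ :=
    { carrier := {n | x ≫ (ψ ^ n).hom.left = x}
      zero_mem' := Category.comp_id x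
      add_mem' := fun {m n} hm hn => by
        simp only [Set.mem_ofPred_eq] at hm hn ⊢
        rw [zpow_add, hmul, ← Category.assoc, hn, hm]
      neg_mem' := fun {n} hn => by
        simp only [Set.mem_ofPred_eq] at hn ⊢
        conv_lhs => rw [← hn]
        rw [Category.assoc, ← hmul, ← zpow_add, neg_add_cancel, zpow_zero]
        exact Category.comp_id x }
  have h1 : (p : ℤ) ∈ H := by
    change x ≫ (ψ ^ (p : ℤ)).hom.left = x
    rw [zpow_natCast, hψ]
    exact Category.comp_id x
  have h2 : (a - b : ℤ) ∈ H := by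
    change x ≫ (ψ ^ (a - b : ℤ)).hom.left = x
    rw [sub_eq_neg_add, zpow_add, hmul, ← Category.assoc, zpow_natCast, h, Category.assoc, ← hmul,
      zpow_neg, zpow_natCast, inv_mul_cancel]
    exact Category.comp_id x
  have hcop : IsCoprime (p : ℤ) (a - b : ℤ) := by
    refine (Nat.prime_iff_prime_int.1 hp).coprime_iff_not_dvd.2 fun hd => hab ?_
    exact ((Nat.modEq_iff_dvd).2 hd).symm
  obtain ⟨u, w, huw⟩ := hcop
  have h3 : (1 : ℤ) ∈ H := by
    rw [← huw, ← smul_eq_mul, ← smul_eq_mul]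
    exact H.add_mem (H.zsmul_mem h1 u) (H.zsmul_mem h2 w)
  change x ≫ (ψ ^ (1 : ℤ)).hom.left = x at h3
  rwa [zpow_one] at h3

/-- A twisted point fixed by `ψ` is Galois invariant, hence a rational fixed point of `ψ`. -/
theorem IsTwistedPoint.exists_fixed_ratPoint [CharZero k] (hp : 0 < p) (hζ : IsPrimitiveRoot ζ p)
    {x : Spec (CommRingCat.of (AlgebraicClosure k)) ⟶ C.left}
    (hx : IsTwistedPoint p ζ ψ d x) (hfix : x ≫ ψ.hom.left = x) :
    ∃ P : RatPoints C k, P ≫ ψ.hom = P := by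
  have hpow : ∀ n : ℕ, x ≫ (ψ ^ n).hom.left = x := fun n => by
    induction n with
    | zero => exact Category.comp_id x
    | succ n ih => rw [aut_pow_succ_hom, Over.comp_left, ← Category.assoc, hfix, ih]
  obtain ⟨δ, hδ⟩ := IsAlgClosed.exists_pow_nat_eq (algebraMap k (AlgebraicClosure k) d) hp
  obtain ⟨P, hP⟩ := exists_ratPoint_of_forall_galois C x hx.comp_hom fun σ => by
    obtain ⟨a, ha⟩ := exists_galois_exponent hp hζ hδ σ
    rw [hx.galois δ hδ σ a ha, hpow]
  refine ⟨P, Over.OverMorphism.ext ?_⟩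
  rw [← cancel_epi (specMap (algebraMap k (AlgebraicClosure k))), Over.comp_left,
    ← Category.assoc, hP, hfix]

/-- Twisted points with the same image in the quotient belong to the same Kummer class. -/
theorem IsTwistedPoint.exists_pow_mul_eq [CharZero k] (hp : p.Prime) (hζ : IsPrimitiveRoot ζ p)
    (hψ : ψ ^ p = 1) (hfix : ¬ ∃ P : RatPoints C k, P ≫ ψ.hom = P)
    {D : Over (Spec (CommRingCat.of k))} {π : C ⟶ D} (hπ : IsQuotientBy ψ π) {d' : k}
    (hd' : d' ≠ 0) {x x' : Spec (CommRingCat.of (AlgebraicClosure k)) ⟶ C.left}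
    (hx : IsTwistedPoint p ζ ψ d x) (hx' : IsTwistedPoint p ζ ψ d' x')
    (hxx' : x ≫ π.left = x' ≫ π.left) :
    ∃ c : k, c ^ p * d' = d := by
  obtain ⟨j, hj⟩ := hπ.exists_comp_pow_eq hp.pos hψ hxx'
  obtain ⟨δ, hδ⟩ := IsAlgClosed.exists_pow_nat_eq (algebraMap k (AlgebraicClosure k) d) hp.pos
  obtain ⟨δ', hδ'⟩ := IsAlgClosed.exists_pow_nat_eq (algebraMap k (AlgebraicClosure k) d') hp.pos
  have h0 : δ' ≠ 0 := by
    rintro rfl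
    rw [zero_pow hp.ne_zero, eq_comm, map_eq_zero] at hδ'
    exact hd' hδ'
  have hmem : δ / δ' ∈ (algebraMap k (AlgebraicClosure k)).range := by
    refine (InfiniteGalois.mem_range_algebraMap_iff_fixed _).2 fun σ => ?_
    obtain ⟨a, ha⟩ := exists_galois_exponent hp.pos hζ hδ σ
    obtain ⟨b, hb⟩ := exists_galois_exponent hp.pos hζ hδ' σ
    have hab : a ≡ b [MOD p] := by
      by_contra hab
      refine hfix (hx'.exists_fixed_ratPoint hp.pos hζ (comp_eq_of_comp_pow_eq hp hψ ?_ hab))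
      rw [← hx'.galois δ' hδ' σ b hb, hj, ← Category.assoc, hx.galois δ hδ σ a ha,
        Category.assoc, Category.assoc, ← Over.comp_left, ← Over.comp_left, ← aut_pow_add_hom,
        ← aut_pow_add_hom, add_comm]
    have hζ0 : algebraMap k (AlgebraicClosure k) (ζ ^ b) ≠ 0 :=
      (map_ne_zero _).2 (pow_ne_zero _ (hζ.ne_zero hp.ne_zero))
    have hζab : ζ ^ a = ζ ^ b := by
      rw [← pow_mod_orderOf ζ a, ← pow_mod_orderOf ζ b, ← hζ.eq_orderOf, show a % p = b % p from hab]
    rw [map_div₀, ha, hb, ← map_pow, ← map_pow, hζab, mul_div_mul_left _ _ hζ0]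
  obtain ⟨c, hc⟩ := hmem
  refine ⟨c, (algebraMap k (AlgebraicClosure k)).injective ?_⟩
  rw [map_mul, map_pow, hc, ← hδ, ← hδ', div_pow, div_mul_cancel₀ _ (pow_ne_zero _ h0)]

end Twist

end KummerTwist

theorem mainTheorem2 {k : Type u} [Field k] [NumberField k]
    (p : ℕ) (hp : p.Prime) (ζ : k) (hζ : IsPrimitiveRoot ζ p)
    (C : Over (Spec (CommRingCat.of k))) (hC : KummerTwist.IsNiceCurve C)
    (ψ : Aut C) (hψ : orderOf ψ = p)
    (hfix_k : ¬ ∃ P : KummerTwist.RatPoints C k, P ≫ ψ.hom = P)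
    (hfix_geom : ∃ P : KummerTwist.RatPoints C (AlgebraicClosure k), P ≫ ψ.hom = P)
    (D : Over (Spec (CommRingCat.of k))) (π : C ⟶ D) (hπ : KummerTwist.IsQuotientBy ψ π)
    (hfin : Finite (KummerTwist.RatPoints D k)) :
    {c : kˣ ⧸ (powMonoidHom p : kˣ →* kˣ).range |
      ∃ (d : kˣ) (Y : Over (Spec (CommRingCat.of k))), (QuotientGroup.mk d = c) ∧
        KummerTwist.IsKummerTwist p ζ ψ (d : k) Y ∧
        Nonempty (KummerTwist.RatPoints Y k)}.Finite := by
  have hψp : ψ ^ p = 1 := hψ ▸ pow_orderOf_eq_one ψ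
  have key : ∀ c : {c : kˣ ⧸ (powMonoidHom p : kˣ →* kˣ).range |
      ∃ (d : kˣ) (Y : Over (Spec (CommRingCat.of k))), (QuotientGroup.mk d = c) ∧
        KummerTwist.IsKummerTwist p ζ ψ (d : k) Y ∧ Nonempty (KummerTwist.RatPoints Y k)},
      ∃ (P : KummerTwist.RatPoints D k) (d : kˣ)
        (x : Spec (CommRingCat.of (AlgebraicClosure k)) ⟶ C.left), QuotientGroup.mk d = c.1 ∧
          KummerTwist.IsTwistedPoint p ζ ψ (d : k) x ∧
          KummerTwist.specMap (algebraMap k (AlgebraicClosure k)) ≫ P.left = x ≫ π.left := by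
    rintro ⟨c, d, Y, hd, hY, ⟨Q⟩⟩
    obtain ⟨x, hx⟩ := KummerTwist.exists_isTwistedPoint hY Q
    obtain ⟨P, hP⟩ := hx.exists_ratPoint hp.pos hζ hπ.invariant
    exact ⟨P, d, x, hd, hx, hP⟩
  choose F d x hd hx hF using key
  have hinj : Function.Injective F := fun c c' h => by
    obtain ⟨e, he⟩ := (hx c).exists_pow_mul_eq hp hζ hψp hfix_k hπ (d c').ne_zero (hx c')
      (by rw [← hF c, ← hF c', h])
    have he0 : e ≠ 0 := by
      rintro rfl
      rw [zero_pow hp.ne_zero, zero_mul] at he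
      exact (d c).ne_zero he.symm
    refine Subtype.ext ?_
    rw [← hd c, ← hd c', eq_comm, QuotientGroup.eq]
    refine ⟨Units.mk0 e he0, ?_⟩
    rw [eq_inv_mul_iff_mul_eq, mul_comm]
    exact Units.ext he
  exact Set.finite_coe_iff.1 (Finite.of_injective F hinj)
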